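/- Let $n\ge 1$. For $J:\mathbb{R}^n\times\mathbb{R}\to\mathbb{R}$ and $r>0$ put $J_r(x,t)=r^{-n-2}J(x/r,t/r^2)$, and write $(J*v)(x,t)=\iint J(x-y,t-s)\,v(y,s)\,dy\,ds$. Let $\mathscr{H}$ be the class of parabolic mean value kernels, that is, of functions $H\ge 0$ in $L^1(\mathbb{R}^{n+1})$ with $\iint H=1$, vanishing for $t<0$, with compact support, radial in $x$ for each $t$, and such that for every domain $\Omega\subset\mathbb{R}^{n+1}$, every solution $v$ of $\partial v/\partial t=\Delta v$ in $\Omega$ and every $(x,t)\in\Omega$ one has $v(x,t)=(H_r*v)(x,t)$ for all sufficiently small $r>0$. For bounded $f:\mathbb{R}^n\to\mathbb{R}$, a solution of the problem $P(J,f)$ is a bounded continuous function $u$ on $\mathbb{R}^{n+1}_+=\mathbb{R}^n\times[0,\infty)$ with $u(x,t)=(J*\overline{u})(x,t)$ for all $x\in\mathbb{R}^n$, $t\ge 0$, where $\overline{u}(x,t)=f(x)$ for $t<0$ and $\overline{u}(x,t)=u(x,t)$ for $t\ge 0$. Let $W(x,t)=(4\pi t)^{-n/2}e^{-|x|^2/(4t)}$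 for $t>0$, and let $W(\cdot,0)*f$ mean $f$. For each $H\in\mathscr{H}$ there is a constant $C>0$ such that, for every $0<\gamma\le 1$ and every bounded $\gamma$-Hölder function $f:\mathbb{R}^n\to\mathbb{R}$, with Hölder seminorm $[f]_\gamma=\sup_{x\ne y}|f(x)-f(y)|/|x-y|^\gamma$, the following holds: for every $r>0$ the problem $P(H_r,f)$ has exactly one solution $u(H_r,f)$, and $$\sup_{(x,t)\in\mathbb{R}^{n+1}_+}\bigl|u(H_r,f)(x,t)-(W(\cdot,t)*f)(x)\bigr|\le C\,[f]_\gamma\,r^\gamma .$$ In particular $u(H_r,f)(x,t)\to (W(\cdot,t)*f)(x)$ uniformly on $\mathbb{R}^{n+1}_+$ as $r\to0^+$. -/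

import Mathlib

open Filter Topology MeasureTheory
open scoped NNReal BoundedContinuousFunction

namespace CTRW

/-- The parabolic rescaling `J_r(x,t) = r^{-(n+2)} J(x/r, t/r²)` of a function on space-time. -/
noncomputable def rescale {n : ℕ} (r : ℝ) (J : EuclideanSpace ℝ (Fin n) × ℝ → ℝ) :
    EuclideanSpace ℝ (Fin n) × ℝ → ℝ :=
  fun p => (r ^ (n + 2))⁻¹ * J (r⁻¹ • p.1, p.2 / r ^ 2)

/-- The space-time convolution `(J ∗ v)(x,t) = ∬ J(x-y,t-s) v(y,s) dy ds`. -/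
noncomputable def conv {n : ℕ} (J v : EuclideanSpace ℝ (Fin n) × ℝ → ℝ) :
    EuclideanSpace ℝ (Fin n) × ℝ → ℝ :=
  fun p => ∫ q : EuclideanSpace ℝ (Fin n) × ℝ, J (p - q) * v q

/-- `v` is a (smooth) solution of the heat equation `∂v/∂t = Δv` in the open set `Ω`
of space-time; the values of `v` outside `Ω` are irrelevant. -/
structure IsTemperatureOn {n : ℕ} (v : EuclideanSpace ℝ (Fin n) × ℝ → ℝ)
    (Ω : Set (EuclideanSpace ℝ (Fin n) × ℝ)) : Prop where
  smooth : ContDiffOn ℝ (⊤ : ℕ∞) v Ω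
  heat : ∀ p ∈ Ω, deriv (fun t : ℝ => v (p.1, t)) p.2 =
    Laplacian.laplacian (fun x : EuclideanSpace ℝ (Fin n) => v (x, p.2)) p.1

/-- The parabolic mean value kernels: space-time probability densities, supported in `t ≥ 0`,
compactly supported, radial in the space variable, for which every temperature satisfies the
mean value formula `v(x,t) = ∬ H_r(x-y,t-s) v(y,s) dy ds` at every point `(x,t)` of its domain,
for all sufficiently small `r > 0`. -/
structure IsMeanValueKernel {n : ℕ} (H : EuclideanSpace ℝ (Fin n) × ℝ → ℝ) : Prop where
  support_subset : Function.support H ⊆ {p | 0 ≤ p.2}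
  nonneg : ∀ p, 0 ≤ H p
  integrable : Integrable H
  integral_eq_one : ∫ p, H p = 1
  hasCompactSupport : HasCompactSupport H
  radial : ∀ (x y : EuclideanSpace ℝ (Fin n)) (t : ℝ), ‖x‖ = ‖y‖ → H (x, t) = H (y, t)
  meanValue : ∀ (Ω : Set (EuclideanSpace ℝ (Fin n) × ℝ)), IsOpen Ω → IsConnected Ω →
    ∀ v : EuclideanSpace ℝ (Fin n) × ℝ → ℝ, IsTemperatureOn v Ω →
      ∀ p ∈ Ω, ∃ r₀ : ℝ, 0 < r₀ ∧ ∀ r : ℝ, 0 < r → r < r₀ → v p = conv (rescale r H) v p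

/-- The extension `ū` of `u` to all of space-time: `ū(x,t) = f(x)` for `t < 0` and
`ū(x,t) = u(x,t)` for `t ≥ 0`. -/
noncomputable def extension {n : ℕ} (f : EuclideanSpace ℝ (Fin n) → ℝ)
    (u : EuclideanSpace ℝ (Fin n) × ℝ≥0 → ℝ) : EuclideanSpace ℝ (Fin n) × ℝ → ℝ :=
  fun p => if p.2 < 0 then f p.1 else u (p.1, p.2.toNNReal)

/-- `u`, bounded and continuous on `ℝⁿ × [0,∞)`, solves the Cauchy problem `P(J,f)`:
`u(x,t) = (J ∗ ū)(x,t)` for all `x` and all `t ≥ 0`. -/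
def IsSolution {n : ℕ} (J : EuclideanSpace ℝ (Fin n) × ℝ → ℝ)
    (f : EuclideanSpace ℝ (Fin n) → ℝ)
    (u : (EuclideanSpace ℝ (Fin n) × ℝ≥0) →ᵇ ℝ) : Prop :=
  ∀ (x : EuclideanSpace ℝ (Fin n)) (t : ℝ≥0), u (x, t) = conv J (extension f u) (x, (t : ℝ))

/-- The Weierstrass kernel `W(x,t) = (4πt)^{-n/2} exp(-|x|²/(4t))`, used for `t > 0`. -/
noncomputable def weierstrass {n : ℕ} (x : EuclideanSpace ℝ (Fin n)) (t : ℝ) : ℝ :=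
  (4 * Real.pi * t) ^ (-(n : ℝ) / 2) * Real.exp (-‖x‖ ^ 2 / (4 * t))

/-- The temperature `W(·,t) ∗ f` on `ℝⁿ × [0,∞)`, with the initial value `f` at `t = 0`. -/
noncomputable def temperature {n : ℕ} (f : EuclideanSpace ℝ (Fin n) → ℝ) :
    EuclideanSpace ℝ (Fin n) × ℝ≥0 → ℝ :=
  fun p => if p.2 = 0 then f p.1 else ∫ y, weierstrass (p.1 - y) (p.2 : ℝ) * f y

end CTRW

/-!
Write `J = H_r`, a probability density on space-time that charges only nonnegative times.

*Solvability.* The equation `u = J ∗ ū` is a Volterra equation with a monotone right-hand side.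
Iterating it from the lower bound `-M` gives an increasing bounded sequence, whose limit is a
solution (`exists_isSolution`); it is continuous since `J ∗ v` is continuous for `J` in `L¹` and `v`
bounded and measurable (`continuous_conv`).

*Stability.* As `ρ = ∬ J e^{-λs} < 1`, the function `min (e^{λt}, e^{λc}) / (1 - ρ)` is at least its
own average over the past, and exceeds it by `1` or more when `0 ≤ t ≤ c`. Hence a bounded function
that is dominated by its average over the past up to an error `δ` at times at most `c`, and up to no
error afterwards, is at most `δ e^{λc} / (1 - ρ)` (`IsCausalDensity.le_of_le_conv_add`). This yields
uniqueness, and it bounds `u - T`, where `T` is the temperature, by the defect `J ∗ T̄ - T`. With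
`λ = r⁻²` and `c` of order `r²` the constant does not depend on `r`.

*Defect.* For `t` of order `r²` the defect is at most a multiple of `[f]_γ r^γ`, because
`|T(x,t) - f(x)|` is at most a multiple of `[f]_γ t^{γ/2}` (`abs_temperature_sub_le`). For larger
`t` it vanishes: the mean value formula at small scales for the temperatures `e^{ξ·x + |ξ|²t}` says
that the entire function `z ↦ ∬ H(y,s) e^{-z ξ·y - z²|ξ|²s}` equals `1` for small `z > 0`, hence
everywhere, and at `z = ir` this is the mean value formula at scale `r` for the characters
`e^{iξ·x - |ξ|²t}` (`IsMeanValueKernel.integral_rescale_cexp`). By Fourier inversion of the Gaussian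
the formula passes to the Weierstrass kernel (`integral_mul_weierstrass_sub`) and to `T`
(`integral_mul_temperature_sub`), at all points from which the support of the kernel reaches only
positive times.
-/

namespace CTRW

/-! ### Convolution with a causal probability density -/

/-- Space-time `ℝⁿ × ℝ`. -/
abbrev SpaceTime (n : ℕ) : Type := EuclideanSpace ℝ (Fin n) × ℝ

instance (n : ℕ) : (volume : Measure (SpaceTime n)).IsAddHaarMeasure :=
  Measure.prod.instIsAddHaarMeasure volume volume

/-- A probability density on space-time that charges only nonnegative times: the law of one step
of the continuous time random walk. -/
structure IsCausalDensity {n : ℕ} (J : SpaceTime n → ℝ) : Prop where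
  nonneg : ∀ p, 0 ≤ J p
  integrable : Integrable J
  integral_eq_one : ∫ p, J p = 1
  eq_zero_of_neg : ∀ p : SpaceTime n, p.2 < 0 → J p = 0

variable {n : ℕ} {H J v w : SpaceTime n → ℝ} {f : EuclideanSpace ℝ (Fin n) → ℝ} {M : ℝ}

theorem conv_eq_integral (J v : SpaceTime n → ℝ) (p : SpaceTime n) :
    conv J v p = ∫ q : SpaceTime n, J q * v (p - q) := by
  rw [conv, ← integral_sub_left_eq_self (fun q : SpaceTime n => J q * v (p - q)) volume p]
  simp

theorem integrable_mul_comp_sub (hJ : Integrable J) (hv : Measurable v)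
    (hM : ∀ p, |v p| ≤ M) (p : SpaceTime n) :
    Integrable fun q : SpaceTime n => J q * v (p - q) :=
  hJ.mul_bdd (c := M) (hv.comp (measurable_const.sub measurable_id)).aestronglyMeasurable
    (ae_of_all _ fun _ => hM _)

theorem conv_sub (hJ : Integrable J) (hv : Measurable v) (hvM : ∃ M, ∀ p, |v p| ≤ M)
    (hw : Measurable w) (hwM : ∃ M, ∀ p, |w p| ≤ M) (p : SpaceTime n) :
    conv J (fun q => v q - w q) p = conv J v p - conv J w p := by
  obtain ⟨M, hM⟩ := hvM
  obtain ⟨M', hM'⟩ := hwM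
  simp only [conv_eq_integral, mul_sub]
  exact integral_sub (integrable_mul_comp_sub hJ hv hM p) (integrable_mul_comp_sub hJ hw hM' p)

theorem abs_conv_sub_le (hJ : Integrable J) {K : SpaceTime n → ℝ} (hK : Integrable K)
    (hv : Measurable v) (hM : ∀ p, |v p| ≤ M) (p : SpaceTime n) :
    |conv J v p - conv K v p| ≤ M * ∫ q, ‖J q - K q‖ := by
  rw [conv_eq_integral, conv_eq_integral,
    ← integral_sub (integrable_mul_comp_sub hJ hv hM p) (integrable_mul_comp_sub hK hv hM p),
    ← integral_const_mul, ← Real.norm_eq_abs]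
  refine norm_integral_le_of_norm_le ((hJ.sub hK).norm.const_mul M) (ae_of_all _ fun q => ?_)
  rw [← sub_mul, norm_mul, mul_comm]
  exact mul_le_mul_of_nonneg_right (hM _) (norm_nonneg _)

/-- Convolution of an integrable kernel with a bounded measurable function is continuous: this is
clear for continuous kernels with compact support, and these are dense in `L¹`. -/
theorem continuous_conv (hJ : Integrable J) (hv : Measurable v) (hM : ∀ p, |v p| ≤ M) :
    Continuous (conv J v) := by
  have hM0 : 0 ≤ M := (abs_nonneg _).trans (hM 0)
  have key : ∀ k : ℕ, ∃ g : SpaceTime n → ℝ, HasCompactSupport g ∧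
      ∫ q, ‖J q - g q‖ ≤ 1 / ((k : ℝ) + 1) ∧ Continuous g ∧ Integrable g := fun k =>
    hJ.exists_hasCompactSupport_integral_sub_le Nat.one_div_pos_of_nat
  choose g hgs hgJ hgc hgi using key
  have hvl : LocallyIntegrable v := by
    refine (locallyIntegrable_const M).mono hv.aestronglyMeasurable (ae_of_all _ fun q => ?_)
    rw [Real.norm_eq_abs, Real.norm_eq_abs, abs_of_nonneg hM0]
    exact hM q
  have hcont : ∀ k, Continuous (conv (g k) v) := fun k => by
    have h := (hgs k).continuous_convolution_right (ContinuousLinearMap.mul ℝ ℝ) hvl (hgc k)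
    refine h.congr fun p => ?_
    simp only [convolution, conv, ContinuousLinearMap.mul_apply', mul_comm]
  have hunif : TendstoUniformly (fun k => conv (g k) v) (conv J v) atTop := by
    rw [Metric.tendstoUniformly_iff]
    intro ε hε
    have hlim : Tendsto (fun k : ℕ => M * (1 / ((k : ℝ) + 1))) atTop (𝓝 0) := by
      simpa using tendsto_one_div_add_atTop_nhds_zero_nat.const_mul M
    filter_upwards [hlim.eventually_lt_const hε] with k hk p
    rw [Real.dist_eq]
    exact (abs_conv_sub_le hJ (hgi k) hv hM p).trans_lt
      ((mul_le_mul_of_nonneg_left (hgJ k) hM0).trans_lt hk)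
  exact hunif.continuous (Frequently.of_forall hcont)

namespace IsCausalDensity

variable (hJ : IsCausalDensity J)
include hJ

theorem conv_mono (hv : Measurable v) (hvM : ∃ M, ∀ p, |v p| ≤ M) (hw : Measurable w)
    (hwM : ∃ M, ∀ p, |w p| ≤ M) (hvw : ∀ p, v p ≤ w p) (p : SpaceTime n) :
    conv J v p ≤ conv J w p := by
  obtain ⟨M, hM⟩ := hvM
  obtain ⟨M', hM'⟩ := hwM
  rw [conv_eq_integral, conv_eq_integral]
  exact integral_mono (integrable_mul_comp_sub hJ.integrable hv hM p)
    (integrable_mul_comp_sub hJ.integrable hw hM' p)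
    fun q => mul_le_mul_of_nonneg_left (hvw _) (hJ.nonneg q)

theorem abs_conv_le (hM : ∀ p, |v p| ≤ M) (p : SpaceTime n) : |conv J v p| ≤ M := by
  rw [conv_eq_integral]
  calc |∫ q : SpaceTime n, J q * v (p - q)| ≤ ∫ q, J q * M := by
        rw [← Real.norm_eq_abs]
        refine norm_integral_le_of_norm_le (hJ.integrable.mul_const M) (ae_of_all _ fun q => ?_)
        rw [norm_mul, Real.norm_of_nonneg (hJ.nonneg q)]
        exact mul_le_mul_of_nonneg_left (hM _) (hJ.nonneg q)
    _ = M := by rw [integral_mul_const, hJ.integral_eq_one, one_mul]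

/-- The exponential weight turns the Volterra operator `v ↦ J ∗ v` into a contraction; the
factor is the Laplace transform of the law of the waiting time. -/
theorem integrable_mul_exp {lam : ℝ} (hlam : 0 < lam) :
    Integrable fun q : SpaceTime n => J q * Real.exp (-(lam * q.2)) := by
  refine hJ.integrable.mono
    (hJ.integrable.aestronglyMeasurable.mul (by fun_prop)) (ae_of_all _ fun q => ?_)
  rcases lt_or_ge q.2 0 with hq | hq
  · simp [hJ.eq_zero_of_neg q hq]
  · rw [norm_mul, Real.norm_of_nonneg (Real.exp_pos _).le]
    exact mul_le_of_le_one_right (norm_nonneg _) (Real.exp_le_one_iff.2 (by nlinarith))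

theorem integral_mul_exp_nonneg (lam : ℝ) :
    0 ≤ ∫ q : SpaceTime n, J q * Real.exp (-(lam * q.2)) :=
  integral_nonneg fun q => mul_nonneg (hJ.nonneg q) (Real.exp_pos _).le

theorem integral_mul_exp_lt_one {lam : ℝ} (hlam : 0 < lam) :
    ∫ q : SpaceTime n, J q * Real.exp (-(lam * q.2)) < 1 := by
  have hnn : ∀ q : SpaceTime n, 0 ≤ J q - J q * Real.exp (-(lam * q.2)) := fun q => by
    rcases lt_or_ge q.2 0 with hq | hq
    · simp [hJ.eq_zero_of_neg q hq]
    · exact sub_nonneg.2 (mul_le_of_le_one_right (hJ.nonneg q)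
        (Real.exp_le_one_iff.2 (by nlinarith)))
  have hint := hJ.integrable.sub (hJ.integrable_mul_exp hlam)
  have hsub : ∫ q : SpaceTime n, (J q - J q * Real.exp (-(lam * q.2))) =
      1 - ∫ q : SpaceTime n, J q * Real.exp (-(lam * q.2)) := by
    rw [integral_sub hJ.integrable (hJ.integrable_mul_exp hlam), hJ.integral_eq_one]
  have hpos := integral_nonneg (μ := volume) (f := fun q => J q - J q * Real.exp (-(lam * q.2))) hnn
  rw [hsub] at hpos
  refine lt_of_le_of_ne (by linarith) fun heq => ?_
  rw [heq, sub_self] at hsub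
  have hae := (integral_eq_zero_iff_of_nonneg hnn hint).1 hsub
  -- a density concentrated on the null set `t = 0` would have integral zero
  have hnull : ∀ᵐ q : SpaceTime n, q.2 ≠ 0 := by
    have : (volume : Measure (SpaceTime n)) (Set.univ ×ˢ {(0 : ℝ)}) = 0 := by
      rw [Measure.volume_eq_prod, Measure.prod_prod]
      simp
    rw [ae_iff]
    convert this using 2
    ext q
    simp
  have hJ0 : J =ᵐ[volume] 0 := by
    filter_upwards [hae, hnull] with q hq hq0
    rcases lt_or_gt_of_ne hq0 with h | h
    · exact hJ.eq_zero_of_neg q h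
    · have hlt : Real.exp (-(lam * q.2)) < 1 := Real.exp_lt_one_iff.2 (by nlinarith)
      have hq' : J q * (1 - Real.exp (-(lam * q.2))) = 0 := by
        rw [mul_sub, mul_one]; exact hq
      exact (mul_eq_zero.1 hq').resolve_right (by linarith)
  have h1 := hJ.integral_eq_one
  rw [integral_congr_ae hJ0] at h1
  simp at h1

/-- Comparison principle. A bounded nonnegative function that is dominated by its average over the
past, up to an error `δ` at times at most `c`, is at most a constant multiple of `δ`. The barrier is
`δ` times `min (exp (lam t)) (exp (lam c)) / (1 - ρ)`, where `ρ = ∬ J exp (-lam s)`. -/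
theorem le_of_le_conv_add {lam c δ A : ℝ} (hlam : 0 < lam) (hδ : 0 ≤ δ)
    {e : SpaceTime n → ℝ} (he : Measurable e) (he0 : ∀ p, 0 ≤ e p) (heA : ∀ p, e p ≤ A)
    (hneg : ∀ p : SpaceTime n, p.2 < 0 → e p = 0)
    (hle : ∀ p : SpaceTime n, 0 ≤ p.2 → e p ≤ conv J e p + if p.2 ≤ c then δ else 0)
    (p : SpaceTime n) :
    e p ≤ δ * (Real.exp (lam * c) / (1 - ∫ q : SpaceTime n, J q * Real.exp (-(lam * q.2)))) := by
  have hρ0 := hJ.integral_mul_exp_nonneg lam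
  have hρ1 := hJ.integral_mul_exp_lt_one hlam
  have hρi := hJ.integrable_mul_exp hlam
  set ρ := ∫ q : SpaceTime n, J q * Real.exp (-(lam * q.2)) with hρ
  have hA : 0 ≤ A := (he0 0).trans (heA 0)
  have h1ρ : 0 < 1 - ρ := by linarith
  let ψ : ℝ → ℝ := fun t => min (Real.exp (lam * t)) (Real.exp (lam * c)) / (1 - ρ)
  have hψ0 : ∀ t, 0 ≤ ψ t := fun t =>
    div_nonneg (le_min (Real.exp_pos _).le (Real.exp_pos _).le) h1ρ.le
  have hψexp : ∀ t, ψ t ≤ Real.exp (lam * t) / (1 - ρ) := fun t =>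
    div_le_div_of_nonneg_right (min_le_left _ _) h1ρ.le
  have hψc : ∀ t, ψ t ≤ Real.exp (lam * c) / (1 - ρ) := fun t =>
    div_le_div_of_nonneg_right (min_le_right _ _) h1ρ.le
  have hψm : Measurable ψ := by fun_prop
  have hexpi : ∀ t : ℝ, Integrable fun q : SpaceTime n => J q * Real.exp (lam * (t - q.2)) := by
    intro t
    refine (hρi.const_mul (Real.exp (lam * t))).congr (ae_of_all _ fun q => ?_)
    show _ = J q * Real.exp (lam * (t - q.2))
    rw [mul_sub, sub_eq_add_neg, Real.exp_add]
    ring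
  have hexp : ∀ t : ℝ, ∫ q : SpaceTime n, J q * Real.exp (lam * (t - q.2)) =
      Real.exp (lam * t) * ρ := by
    intro t
    rw [hρ, ← integral_const_mul]
    congr 1 with q
    rw [mul_sub, sub_eq_add_neg, Real.exp_add]
    ring
  have hψi : ∀ t : ℝ, Integrable fun q : SpaceTime n => J q * ψ (t - q.2) := fun t =>
    hJ.integrable.mul_bdd (c := Real.exp (lam * c) / (1 - ρ))
      (hψm.comp (measurable_const.sub measurable_snd)).aestronglyMeasurable
      (ae_of_all _ fun q => by
        rw [Real.norm_of_nonneg (hψ0 _)]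
        exact hψc _)
  -- the barrier strictly exceeds its own average up to time `c`
  have hbar : ∀ t : ℝ, 0 ≤ t →
      (∫ q : SpaceTime n, J q * ψ (t - q.2)) + (if t ≤ c then 1 else 0) ≤ ψ t := by
    intro t ht
    split_ifs with htc
    · have hψt : ψ t = Real.exp (lam * t) / (1 - ρ) := by
        simp only [ψ]
        rw [min_eq_left (Real.exp_le_exp.2 (by nlinarith))]
      have h1 : ∫ q : SpaceTime n, J q * ψ (t - q.2) ≤
          ∫ q : SpaceTime n, J q * Real.exp (lam * (t - q.2)) * (1 - ρ)⁻¹ := by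
        refine integral_mono (hψi t) ((hexpi t).mul_const _) fun q => ?_
        show J q * ψ (t - q.2) ≤ J q * Real.exp (lam * (t - q.2)) * (1 - ρ)⁻¹
        rw [mul_assoc]
        exact mul_le_mul_of_nonneg_left (hψexp _) (hJ.nonneg q)
      rw [integral_mul_const, hexp] at h1
      have h2 : (1 : ℝ) ≤ Real.exp (lam * t) := Real.one_le_exp (by positivity)
      have h3 : Real.exp (lam * t) / (1 - ρ) =
          Real.exp (lam * t) * ρ * (1 - ρ)⁻¹ + Real.exp (lam * t) := by
        field_simp
        ring
      rw [hψt, h3]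
      linarith
    · have hψt : ψ t = Real.exp (lam * c) / (1 - ρ) := by
        simp only [ψ]
        rw [min_eq_right (Real.exp_le_exp.2 (by nlinarith))]
      have h1 : ∫ q : SpaceTime n, J q * ψ (t - q.2) ≤
          ∫ q : SpaceTime n, J q * (Real.exp (lam * c) / (1 - ρ)) :=
        integral_mono (hψi t) (hJ.integrable.mul_const _) fun q =>
          mul_le_mul_of_nonneg_left (hψc _) (hJ.nonneg q)
      rw [integral_mul_const, hJ.integral_eq_one, one_mul] at h1
      rw [hψt]
      linarith
  have hiter : ∀ (k : ℕ) (p : SpaceTime n),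
      e p ≤ δ * ψ p.2 + A * ρ ^ k * Real.exp (lam * p.2) := by
    intro k
    induction k with
    | zero =>
      intro p
      rcases lt_or_ge p.2 0 with hp | hp
      · rw [hneg p hp]
        have := hψ0 p.2
        positivity
      · have h1 : A ≤ A * ρ ^ 0 * Real.exp (lam * p.2) := by
          rw [pow_zero, mul_one]
          exact le_mul_of_one_le_right hA (Real.one_le_exp (by positivity))
        have h2 := mul_nonneg hδ (hψ0 p.2)
        linarith [heA p]
    | succ k ih =>
      intro p
      rcases lt_or_ge p.2 0 with hp | hp
      · rw [hneg p hp]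
        have := hψ0 p.2
        positivity
      · have h1 : conv J e p ≤ ∫ q : SpaceTime n, (δ * (J q * ψ (p.2 - q.2)) +
            A * ρ ^ k * (J q * Real.exp (lam * (p.2 - q.2)))) := by
          rw [conv_eq_integral]
          refine integral_mono (integrable_mul_comp_sub hJ.integrable he (M := A)
            (fun q => by rw [abs_of_nonneg (he0 q)]; exact heA q) p)
            (((hψi p.2).const_mul δ).add ((hexpi p.2).const_mul (A * ρ ^ k))) fun q => ?_
          calc J q * e (p - q)
              ≤ J q * (δ * ψ (p.2 - q.2) + A * ρ ^ k * Real.exp (lam * (p.2 - q.2))) :=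
                mul_le_mul_of_nonneg_left (ih (p - q)) (hJ.nonneg q)
            _ = _ := by ring
        rw [integral_add ((hψi p.2).const_mul δ) ((hexpi p.2).const_mul (A * ρ ^ k)),
          integral_const_mul, integral_const_mul, hexp] at h1
        have h2 := mul_le_mul_of_nonneg_left (hbar p.2 hp) hδ
        have h3 := hle p hp
        have h4 : (if p.2 ≤ c then δ else 0) = δ * (if p.2 ≤ c then 1 else 0) := by
          split_ifs <;> simp
        rw [h4] at h3
        rw [pow_succ]
        nlinarith [h1, h2, h3]
  have hlim : Tendsto (fun k : ℕ => δ * ψ p.2 + A * ρ ^ k * Real.exp (lam * p.2)) atTop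
      (𝓝 (δ * ψ p.2 + A * 0 * Real.exp (lam * p.2))) :=
    (((tendsto_pow_atTop_nhds_zero_of_lt_one hρ0 hρ1).const_mul A).mul_const _).const_add _
  have hfin := ge_of_tendsto' hlim fun k => hiter k p
  rw [mul_zero, zero_mul, add_zero] at hfin
  exact hfin.trans (mul_le_mul_of_nonneg_left (hψc _) hδ)

end IsCausalDensity

/-! ### Existence and uniqueness for the Cauchy problem -/

theorem extension_of_neg (f : EuclideanSpace ℝ (Fin n) → ℝ)
    (u : EuclideanSpace ℝ (Fin n) × ℝ≥0 → ℝ) {p : SpaceTime n} (hp : p.2 < 0) :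
    extension f u p = f p.1 := if_pos hp

theorem extension_of_nonneg (f : EuclideanSpace ℝ (Fin n) → ℝ)
    (u : EuclideanSpace ℝ (Fin n) × ℝ≥0 → ℝ) {p : SpaceTime n} (hp : 0 ≤ p.2) :
    extension f u p = u (p.1, p.2.toNNReal) := if_neg hp.not_gt

theorem extension_coe (f : EuclideanSpace ℝ (Fin n) → ℝ)
    (u : EuclideanSpace ℝ (Fin n) × ℝ≥0 → ℝ) (x : EuclideanSpace ℝ (Fin n)) (t : ℝ≥0) :
    extension f u (x, (t : ℝ)) = u (x, t) := by
  rw [extension_of_nonneg f u t.coe_nonneg, Real.toNNReal_coe]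

theorem measurable_extension (hf : Measurable f) {u : EuclideanSpace ℝ (Fin n) × ℝ≥0 → ℝ}
    (hu : Measurable u) : Measurable (extension f u) :=
  Measurable.ite (measurableSet_lt measurable_snd measurable_const) (hf.comp measurable_fst)
    (hu.comp (measurable_fst.prodMk measurable_snd.real_toNNReal))

theorem abs_extension_le {N : ℝ} (hf : ∀ x, |f x| ≤ M)
    {u : EuclideanSpace ℝ (Fin n) × ℝ≥0 → ℝ} (hu : ∀ p, |u p| ≤ N) (p : SpaceTime n) :
    |extension f u p| ≤ max M N := by
  unfold extension
  split_ifs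
  · exact (hf _).trans (le_max_left _ _)
  · exact (hu _).trans (le_max_right _ _)

/-- The Picard iterates for `u = J ∗ ū`, regarded as functions on all of space-time. Starting from
the lower bound `-M` for positive times makes the sequence increasing. -/
noncomputable def picardIterate (J : SpaceTime n → ℝ) (f : EuclideanSpace ℝ (Fin n) → ℝ) (M : ℝ) :
    ℕ → SpaceTime n → ℝ
  | 0 => fun p => if p.2 < 0 then f p.1 else -M
  | k + 1 => fun p => if p.2 < 0 then f p.1 else conv J (picardIterate J f M k) p

theorem abs_picardIterate_le (hJ : IsCausalDensity J) (hfM : ∀ x, |f x| ≤ M) (k : ℕ) :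
    ∀ p, |picardIterate J f M k p| ≤ M := by
  have hM : 0 ≤ M := (abs_nonneg _).trans (hfM 0)
  induction k with
  | zero =>
    intro p
    simp only [picardIterate]
    split_ifs
    · exact hfM _
    · rw [abs_neg, abs_of_nonneg hM]
  | succ k ih =>
    intro p
    simp only [picardIterate]
    split_ifs
    · exact hfM _
    · exact hJ.abs_conv_le ih p

theorem measurable_picardIterate (hJ : IsCausalDensity J) (hf : Measurable f)
    (hfM : ∀ x, |f x| ≤ M) (k : ℕ) : Measurable (picardIterate J f M k) := by
  induction k with
  | zero =>
    exact Measurable.ite (measurableSet_lt measurable_snd measurable_const)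
      (hf.comp measurable_fst) measurable_const
  | succ k ih =>
    exact Measurable.ite (measurableSet_lt measurable_snd measurable_const)
      (hf.comp measurable_fst)
      (continuous_conv hJ.integrable ih (abs_picardIterate_le hJ hfM k)).measurable

theorem picardIterate_le_succ (hJ : IsCausalDensity J) (hf : Measurable f)
    (hfM : ∀ x, |f x| ≤ M) (k : ℕ) :
    ∀ p, picardIterate J f M k p ≤ picardIterate J f M (k + 1) p := by
  induction k with
  | zero =>
    intro p
    simp only [picardIterate]
    split_ifs
    · exact le_rfl
    · exact (abs_le.1 (hJ.abs_conv_le (abs_picardIterate_le hJ hfM 0) p)).1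
  | succ k ih =>
    intro p
    show (if p.2 < 0 then f p.1 else conv J (picardIterate J f M k) p) ≤
      if p.2 < 0 then f p.1 else conv J (picardIterate J f M (k + 1)) p
    split_ifs
    · exact le_rfl
    · exact hJ.conv_mono (measurable_picardIterate hJ hf hfM k)
        ⟨M, abs_picardIterate_le hJ hfM k⟩ (measurable_picardIterate hJ hf hfM (k + 1))
        ⟨M, abs_picardIterate_le hJ hfM (k + 1)⟩ ih p

/-- The problem `P(J,f)` has a solution, the limit of the increasing sequence of Picard iterates;
it is continuous because it is a convolution with `J`. -/
theorem exists_isSolution (hJ : IsCausalDensity J) (hf : Measurable f) (hfM : ∀ x, |f x| ≤ M) :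
    ∃ u : (EuclideanSpace ℝ (Fin n) × ℝ≥0) →ᵇ ℝ, IsSolution J f u := by
  have hbd := abs_picardIterate_le hJ hfM
  have hmeas := measurable_picardIterate hJ hf hfM
  let w : SpaceTime n → ℝ := fun p => ⨆ k, picardIterate J f M k p
  have hlim : ∀ p, Tendsto (fun k => picardIterate J f M k p) atTop (𝓝 (w p)) := fun p =>
    tendsto_atTop_ciSup (monotone_nat_of_le_succ fun k => picardIterate_le_succ hJ hf hfM k p)
      ⟨M, by rintro _ ⟨k, rfl⟩; exact (abs_le.1 (hbd k p)).2⟩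
  have hwM : ∀ p, |w p| ≤ M := fun p => le_of_tendsto' (hlim p).abs fun k => hbd k p
  have hwm : Measurable w := measurable_of_tendsto_metrizable hmeas (tendsto_pi_nhds.2 hlim)
  have hconv : ∀ p, Tendsto (fun k => conv J (picardIterate J f M k) p) atTop
      (𝓝 (conv J w p)) := by
    intro p
    simp only [conv_eq_integral]
    refine tendsto_integral_of_dominated_convergence (fun q => ‖J q‖ * M)
      (fun k => (integrable_mul_comp_sub hJ.integrable (hmeas k) (hbd k) p).aestronglyMeasurable)
      (hJ.integrable.norm.mul_const M) (fun k => ae_of_all _ fun q => ?_)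
      (ae_of_all _ fun q => (hlim _).const_mul _)
    rw [norm_mul]
    exact mul_le_mul_of_nonneg_left (hbd k _) (norm_nonneg _)
  have hw_neg : ∀ p : SpaceTime n, p.2 < 0 → w p = f p.1 := fun p hp =>
    tendsto_nhds_unique (hlim p) (tendsto_const_nhds.congr fun k => by
      cases k <;> simp only [picardIterate] <;> rw [if_pos hp])
  have hw_nonneg : ∀ p : SpaceTime n, 0 ≤ p.2 → w p = conv J w p := fun p hp =>
    tendsto_nhds_unique ((hlim p).comp (tendsto_add_atTop_nat 1)) ((hconv p).congr fun k => by
      simp only [Function.comp_apply, picardIterate]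
      rw [if_neg hp.not_gt])
  have hcont : Continuous fun p : EuclideanSpace ℝ (Fin n) × ℝ≥0 =>
      conv J w (p.1, (p.2 : ℝ)) :=
    (continuous_conv hJ.integrable hwm hwM).comp (by fun_prop)
  let u : (EuclideanSpace ℝ (Fin n) × ℝ≥0) →ᵇ ℝ :=
    BoundedContinuousFunction.ofNormedAddCommGroup _ hcont M fun p => hJ.abs_conv_le hwM _
  have hu : ∀ p, u p = conv J w (p.1, (p.2 : ℝ)) := fun p => rfl
  have hext : extension f u = w := by
    funext p
    rcases lt_or_ge p.2 0 with hp | hp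
    · rw [extension_of_neg f u hp, hw_neg p hp]
    · rw [extension_of_nonneg f u hp, hu, Real.coe_toNNReal _ hp, hw_nonneg p hp]
  refine ⟨u, fun x t => ?_⟩
  rw [hext, hu]

/-- Stability: if `u` solves `P(J,f)` and `T` solves it up to an error `δ`, which is present at times
at most `c` only, then `u` and `T` differ by a multiple of `δ`. -/
theorem IsSolution.abs_sub_le (hJ : IsCausalDensity J) {lam c δ : ℝ} (hlam : 0 < lam)
    (hδ : 0 ≤ δ) (hf : Measurable f) (hfM : ∀ x, |f x| ≤ M)
    {u : (EuclideanSpace ℝ (Fin n) × ℝ≥0) →ᵇ ℝ} (hu : IsSolution J f u)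
    {T : EuclideanSpace ℝ (Fin n) × ℝ≥0 → ℝ} (hT : Measurable T) (hTM : ∃ N, ∀ p, |T p| ≤ N)
    (hdefect : ∀ (x : EuclideanSpace ℝ (Fin n)) (t : ℝ≥0),
      |conv J (extension f T) (x, (t : ℝ)) - T (x, t)| ≤ if (t : ℝ) ≤ c then δ else 0)
    (p : EuclideanSpace ℝ (Fin n) × ℝ≥0) :
    |u p - T p| ≤
      δ * (Real.exp (lam * c) / (1 - ∫ q : SpaceTime n, J q * Real.exp (-(lam * q.2)))) := by
  obtain ⟨N, hN⟩ := hTM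
  have hum := measurable_extension hf u.continuous.measurable
  have huM := abs_extension_le hfM (u := u) (N := ‖u‖) u.norm_coe_le_norm
  have hTm := measurable_extension hf hT
  have hTN := abs_extension_le hfM hN
  have hUu : ∀ x t, extension f u (x, (t : ℝ≥0)) = u (x, t) := extension_coe f u
  have hVT : ∀ x t, extension f T (x, (t : ℝ≥0)) = T (x, t) := extension_coe f T
  have hUV0 : ∀ q : SpaceTime n, q.2 < 0 → |extension f u q - extension f T q| = 0 := fun q hq => by
    rw [extension_of_neg _ _ hq, extension_of_neg _ _ hq, sub_self, abs_zero]
  set U := extension f u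
  set V := extension f T
  have hbd : ∀ q, |U q - V q| ≤ max M ‖u‖ + max M N := fun q =>
    (abs_sub _ _).trans (add_le_add (huM q) (hTN q))
  have hle : ∀ q : SpaceTime n, 0 ≤ q.2 →
      |U q - V q| ≤ conv J (fun q => |U q - V q|) q + if q.2 ≤ c then δ else 0 := by
    rintro ⟨x, t⟩ ht
    lift t to ℝ≥0 using ht
    have hUV : U (x, (t : ℝ)) - V (x, (t : ℝ)) = conv J (fun q => U q - V q) (x, (t : ℝ)) +
        (conv J V (x, (t : ℝ)) - T (x, t)) := by
      rw [conv_sub hJ.integrable hum ⟨_, huM⟩ hTm ⟨_, hTN⟩, hUu, hVT, hu x t]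
      ring
    rw [hUV]
    refine (abs_add_le _ _).trans (add_le_add ?_ (hdefect x t))
    rw [conv_eq_integral, conv_eq_integral]
    refine abs_integral_le_integral_abs.trans_eq ?_
    congr 1 with q
    rw [abs_mul, abs_of_nonneg (hJ.nonneg q)]
  have h := hJ.le_of_le_conv_add hlam hδ (e := fun q => |U q - V q|) (hum.sub hTm).abs
    (fun q => abs_nonneg _) hbd hUV0 hle (p.1, (p.2 : ℝ))
  simpa only [hUu, hVT] using h

theorem IsSolution.unique (hJ : IsCausalDensity J) (hf : Measurable f) (hfM : ∀ x, |f x| ≤ M)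
    {u w : (EuclideanSpace ℝ (Fin n) × ℝ≥0) →ᵇ ℝ} (hu : IsSolution J f u)
    (hw : IsSolution J f w) : u = w := by
  ext p
  have h := hu.abs_sub_le hJ one_pos le_rfl (c := 0) hf hfM w.continuous.measurable
    ⟨‖w‖, w.norm_coe_le_norm⟩ (fun x t => by rw [← hw x t]; simp) p
  rw [zero_mul] at h
  exact sub_eq_zero.1 (abs_nonpos_iff.1 h)

/-! ### The Weierstrass kernel -/

theorem weierstrass_nonneg (x : EuclideanSpace ℝ (Fin n)) {t : ℝ} (ht : 0 ≤ t) :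
    0 ≤ weierstrass x t :=
  mul_nonneg (Real.rpow_nonneg (by positivity) _) (Real.exp_pos _).le

theorem measurable_weierstrass :
    Measurable fun p : SpaceTime n => weierstrass p.1 p.2 := by
  unfold weierstrass
  fun_prop

theorem integral_weierstrass {t : ℝ} (ht : 0 < t) :
    ∫ x : EuclideanSpace ℝ (Fin n), weierstrass x t = 1 := by
  have h := GaussianFourier.integral_rexp_neg_mul_sq_norm
    (V := EuclideanSpace ℝ (Fin n)) (b := (4 * t)⁻¹) (by positivity)
  have hpos : 0 < 4 * Real.pi * t := by positivity
  have hpi : Real.pi / (4 * t)⁻¹ = 4 * Real.pi * t := by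
    rw [div_inv_eq_mul]
    ring
  rw [finrank_euclideanSpace_fin, hpi] at h
  have heq : ∀ x : EuclideanSpace ℝ (Fin n),
      weierstrass x t = (4 * Real.pi * t) ^ (-(n : ℝ) / 2) * Real.exp (-(4 * t)⁻¹ * ‖x‖ ^ 2) := by
    intro x
    rw [weierstrass]
    congr 2
    rw [div_eq_mul_inv]
    ring
  simp only [heq]
  rw [integral_const_mul, h, ← Real.rpow_add hpos]
  ring_nf
  exact Real.rpow_zero _

theorem integrable_weierstrass {t : ℝ} (ht : 0 < t) :
    Integrable fun x : EuclideanSpace ℝ (Fin n) => weierstrass x t :=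
  Integrable.of_integral_ne_zero (by rw [integral_weierstrass ht]; exact one_ne_zero)

/-- Polynomial moments of a Gaussian are absorbed by a Gaussian of twice the variance. -/
theorem weierstrass_mul_rpow_le (x : EuclideanSpace ℝ (Fin n)) {t γ : ℝ} (ht : 0 < t)
    (hγ0 : 0 ≤ γ) (hγ1 : γ ≤ 1) :
    weierstrass x t * ‖x‖ ^ γ ≤
      8 * 2 ^ ((n : ℝ) / 2) * √t ^ γ * weierstrass x (2 * t) := by
  have hs : 0 < √t := Real.sqrt_pos.2 ht
  set a := ‖x‖ / √t with ha
  have ha0 : 0 ≤ a := by positivity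
  have hx : ‖x‖ = √t * a := by rw [ha]; field_simp
  have ha2 : ‖x‖ ^ 2 = t * a ^ 2 := by rw [hx, mul_pow, Real.sq_sqrt ht.le]
  have h1 : a ^ γ ≤ 8 * Real.exp (a ^ 2 / 8) := by
    have h2 : a ^ γ ≤ 1 + a ^ 2 := by
      rcases le_total a 1 with h | h
      · exact (Real.rpow_le_one ha0 h hγ0).trans (by nlinarith)
      · have := Real.rpow_le_rpow_of_exponent_le h hγ1
        rw [Real.rpow_one] at this
        nlinarith
    have h3 := Real.add_one_le_exp (a ^ 2 / 8)
    linarith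
  have hW : weierstrass x t * Real.exp (a ^ 2 / 8) =
      2 ^ ((n : ℝ) / 2) * weierstrass x (2 * t) := by
    have e1 : 4 * Real.pi * (2 * t) = 2 * (4 * Real.pi * t) := by ring
    rw [weierstrass, weierstrass, e1,
      Real.mul_rpow zero_le_two (by positivity : 0 ≤ 4 * Real.pi * t),
      mul_assoc, ← Real.exp_add, ← mul_assoc, ← mul_assoc, ← Real.rpow_add two_pos, ha2]
    have e2 : (n : ℝ) / 2 + -(n : ℝ) / 2 = 0 := by ring
    rw [e2, Real.rpow_zero, one_mul]
    congr 2
    field_simp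
    ring
  calc weierstrass x t * ‖x‖ ^ γ = √t ^ γ * (weierstrass x t * a ^ γ) := by
        rw [hx, Real.mul_rpow hs.le ha0]
        ring
    _ ≤ √t ^ γ * (weierstrass x t * (8 * Real.exp (a ^ 2 / 8))) := by
        have := weierstrass_nonneg x ht.le
        gcongr
    _ = √t ^ γ * (8 * (weierstrass x t * Real.exp (a ^ 2 / 8))) := by ring
    _ = _ := by
        rw [hW]
        ring

open Complex in
/-- The Weierstrass kernel as the Fourier transform of `exp (-t|ξ|²)`. -/
theorem weierstrass_eq_integral_cexp (x : EuclideanSpace ℝ (Fin n)) {t : ℝ} (ht : 0 < t) :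
    ((weierstrass x t : ℝ) : ℂ) = (((2 * Real.pi) ^ n)⁻¹ : ℝ) *
      ∫ ξ : EuclideanSpace ℝ (Fin n), cexp (-t * ‖ξ‖ ^ 2 + I * inner ℝ x ξ) := by
  rw [GaussianFourier.integral_cexp_neg_mul_sq_norm_add (by simpa using ht),
    finrank_euclideanSpace_fin]
  have hb : 0 < Real.pi / t := by positivity
  have h1 : ((Real.pi : ℂ) / t) ^ ((n : ℂ) / 2) = (((Real.pi / t) ^ ((n : ℝ) / 2) : ℝ) : ℂ) := by
    rw [Complex.ofReal_cpow hb.le]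
    push_cast
    rfl
  have h2 : cexp (I ^ 2 * ‖x‖ ^ 2 / (4 * t)) = ((Real.exp (-‖x‖ ^ 2 / (4 * t)) : ℝ) : ℂ) := by
    push_cast
    rw [I_sq]
    ring_nf
  rw [h1, h2, weierstrass]
  rw [← ofReal_mul, ← ofReal_mul, ofReal_inj, ← mul_assoc]
  congr 1
  have h3 : 4 * Real.pi * t = (2 * Real.pi) ^ (2 : ℝ) * (Real.pi / t)⁻¹ := by
    rw [Real.rpow_two]
    field_simp
    ring
  rw [h3, Real.mul_rpow (by positivity) (by positivity), ← Real.rpow_mul (by positivity),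
    Real.inv_rpow hb.le, ← Real.rpow_neg hb.le]
  have h4 : (2 : ℝ) * (-(n : ℝ) / 2) = -(n : ℝ) := by ring
  have h5 : -(-(n : ℝ) / 2) = (n : ℝ) / 2 := by ring
  rw [h4, h5, Real.rpow_neg (by positivity), Real.rpow_natCast]

/-! ### The temperature with Hölder initial values -/

theorem temperature_of_pos (f : EuclideanSpace ℝ (Fin n) → ℝ) (x : EuclideanSpace ℝ (Fin n))
    {t : ℝ≥0} (ht : 0 < t) :
    temperature f (x, t) = ∫ y, weierstrass y (t : ℝ) * f (x - y) := by
  rw [temperature, if_neg ht.ne',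
    ← integral_sub_left_eq_self (fun y => weierstrass y (t : ℝ) * f (x - y)) volume x]
  simp

theorem measurable_temperature (hf : Measurable f) : Measurable (temperature f) := by
  refine Measurable.ite (measurable_snd (measurableSet_singleton 0)) (hf.comp measurable_fst) ?_
  have h : Measurable fun z : (EuclideanSpace ℝ (Fin n) × ℝ≥0) × EuclideanSpace ℝ (Fin n) =>
      weierstrass (z.1.1 - z.2) (z.1.2 : ℝ) * f z.2 :=
    (measurable_weierstrass.comp (by fun_prop :
      Measurable fun z : (EuclideanSpace ℝ (Fin n) × ℝ≥0) × EuclideanSpace ℝ (Fin n) =>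
        (z.1.1 - z.2, (z.1.2 : ℝ)))).mul (hf.comp measurable_snd)
  exact h.stronglyMeasurable.integral_prod_right.measurable

theorem abs_temperature_le (hM : ∀ x, |f x| ≤ M) (p : EuclideanSpace ℝ (Fin n) × ℝ≥0) :
    |temperature f p| ≤ M := by
  obtain ⟨x, t⟩ := p
  rcases eq_or_lt_of_le (zero_le (a := t)) with rfl | ht
  · rw [temperature, if_pos rfl]
    exact hM x
  · have ht' : (0 : ℝ) < t := ht
    rw [temperature_of_pos f x ht, ← Real.norm_eq_abs]
    calc ‖∫ y, weierstrass y (t : ℝ) * f (x - y)‖ ≤ ∫ y, weierstrass y (t : ℝ) * M := by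
          refine norm_integral_le_of_norm_le ((integrable_weierstrass ht').mul_const M)
            (ae_of_all _ fun y => ?_)
          rw [norm_mul, Real.norm_of_nonneg (weierstrass_nonneg y ht'.le)]
          exact mul_le_mul_of_nonneg_left (hM _) (weierstrass_nonneg y ht'.le)
      _ = M := by rw [integral_mul_const, integral_weierstrass ht', one_mul]

/-- A constant for the modulus of continuity in time of the temperatures in `ℝⁿ`. -/
noncomputable def momentConst (n : ℕ) : ℝ := 8 * 2 ^ ((n : ℝ) / 2)

theorem one_le_momentConst (n : ℕ) : 1 ≤ momentConst n := by
  have : (1 : ℝ) ≤ 2 ^ ((n : ℝ) / 2) := Real.one_le_rpow (by norm_num) (by positivity)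
  unfold momentConst
  linarith

/-- The temperature leaves its Hölder initial values at rate `t ^ (γ / 2)`. -/
theorem abs_temperature_sub_le {L γ : ℝ} (hγ0 : 0 < γ) (hγ1 : γ ≤ 1) (hf : Measurable f)
    (hM : ∀ x, |f x| ≤ M) (hL : 0 ≤ L) (hfL : ∀ x y, |f x - f y| ≤ L * ‖x - y‖ ^ γ)
    (x : EuclideanSpace ℝ (Fin n)) (t : ℝ≥0) :
    |temperature f (x, t) - f x| ≤ L * momentConst n * √(t : ℝ) ^ γ := by
  rcases eq_or_lt_of_le (zero_le (a := t)) with rfl | ht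
  · rw [temperature, if_pos rfl]
    simp [Real.zero_rpow hγ0.ne']
  · have ht' : (0 : ℝ) < t := ht
    have hW := integrable_weierstrass (n := n) ht'
    have hWf : Integrable fun y => weierstrass y (t : ℝ) * f (x - y) :=
      hW.mul_bdd (c := M) (hf.comp (measurable_const.sub measurable_id)).aestronglyMeasurable
        (ae_of_all _ fun _ => hM _)
    have heq : temperature f (x, t) - f x =
        ∫ y, (weierstrass y (t : ℝ) * f (x - y) - weierstrass y (t : ℝ) * f x) := by
      rw [integral_sub hWf (hW.mul_const _), integral_mul_const, integral_weierstrass ht',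
        one_mul, temperature_of_pos f x ht]
    rw [heq, ← Real.norm_eq_abs]
    calc _ ≤ ∫ y : EuclideanSpace ℝ (Fin n),
          L * momentConst n * √(t : ℝ) ^ γ * weierstrass y (2 * (t : ℝ)) := by
          refine norm_integral_le_of_norm_le
            ((integrable_weierstrass (by positivity)).const_mul _) (ae_of_all _ fun y => ?_)
          have hW0 := weierstrass_nonneg y ht'.le
          rw [← mul_sub, norm_mul, Real.norm_of_nonneg hW0, Real.norm_eq_abs]
          calc weierstrass y (t : ℝ) * |f (x - y) - f x|
              ≤ weierstrass y (t : ℝ) * (L * ‖y‖ ^ γ) := by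
                refine mul_le_mul_of_nonneg_left ((hfL _ _).trans_eq ?_) hW0
                rw [sub_sub_cancel_left, norm_neg]
            _ = L * (weierstrass y (t : ℝ) * ‖y‖ ^ γ) := by ring
            _ ≤ L * (8 * 2 ^ ((n : ℝ) / 2) * √(t : ℝ) ^ γ * weierstrass y (2 * (t : ℝ))) :=
                mul_le_mul_of_nonneg_left (weierstrass_mul_rpow_le y ht' hγ0.le hγ1) hL
            _ = _ := by
                rw [momentConst]
                ring
      _ = _ := by
          rw [integral_const_mul, integral_weierstrass (by positivity), mul_one]

/-! ### Parabolic rescaling -/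

/-- The parabolic dilation `(y, s) ↦ (r y, r² s)` of space-time. -/
def dilate (r : ℝ) (q : SpaceTime n) : SpaceTime n := (r • q.1, r ^ 2 * q.2)

theorem measurableEmbedding_dilate {r : ℝ} (hr : 0 < r) :
    MeasurableEmbedding (dilate r : SpaceTime n → SpaceTime n) :=
  ((Homeomorph.smulOfNeZero r hr.ne').prodCongr
    (Homeomorph.mulLeft₀ (r ^ 2) (pow_ne_zero 2 hr.ne'))).measurableEmbedding

theorem map_dilate_volume {r : ℝ} (hr : 0 < r) :
    Measure.map (dilate r) (volume : Measure (SpaceTime n)) =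
      ENNReal.ofReal (r ^ (n + 2))⁻¹ • volume := by
  have h1 : Measure.map (r • ·) (volume : Measure (EuclideanSpace ℝ (Fin n))) =
      ENNReal.ofReal (r ^ n)⁻¹ • volume := by
    rw [Measure.map_addHaar_smul _ hr.ne', finrank_euclideanSpace_fin,
      abs_of_pos (inv_pos.2 (pow_pos hr n))]
  have h2 : Measure.map (r ^ 2 * ·) (volume : Measure ℝ) =
      ENNReal.ofReal (r ^ 2)⁻¹ • volume := by
    rw [Real.map_volume_mul_left (pow_ne_zero 2 hr.ne'), abs_of_pos (inv_pos.2 (pow_pos hr 2))]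
  have h3 := Measure.map_prod_map (volume : Measure (EuclideanSpace ℝ (Fin n))) (volume : Measure ℝ)
    (measurable_const_smul r) (measurable_const_mul (r ^ 2))
  rw [h1, h2, Measure.prod_smul_left, Measure.prod_smul_right, smul_smul,
    ← ENNReal.ofReal_mul (by positivity)] at h3
  rw [Measure.volume_eq_prod, pow_add, mul_inv, h3]
  rfl

theorem rescale_dilate {r : ℝ} (hr : 0 < r) (H : SpaceTime n → ℝ) (q : SpaceTime n) :
    rescale r H (dilate r q) = (r ^ (n + 2))⁻¹ * H q := by
  have h1 : r⁻¹ • r • q.1 = q.1 := inv_smul_smul₀ hr.ne' _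
  have h2 : r ^ 2 * q.2 / r ^ 2 = q.2 := mul_div_cancel_left₀ _ (pow_ne_zero 2 hr.ne')
  simp only [rescale, dilate, h1, h2]

/-- Rescaling the kernel amounts to dilating the integrand; no integrability is needed. -/
theorem integral_rescale_smul {E : Type*} [NormedAddCommGroup E] [NormedSpace ℝ E]
    {r : ℝ} (hr : 0 < r) (H : SpaceTime n → ℝ) (g : SpaceTime n → E) :
    ∫ q, rescale r H q • g q = ∫ q, H q • g (dilate r q) := by
  have hpos : 0 < (r ^ (n + 2))⁻¹ := by positivity
  have h := (measurableEmbedding_dilate (n := n) hr).integral_map (μ := volume)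
    fun q => rescale r H q • g q
  simp only [map_dilate_volume hr, integral_smul_measure, ENNReal.toReal_ofReal hpos.le,
    rescale_dilate hr, mul_smul, integral_smul] at h
  exact smul_right_injective E hpos.ne' h

theorem integrable_rescale {r : ℝ} (hr : 0 < r) (hH : Integrable H) :
    Integrable (rescale r H) := by
  have hpos : 0 < (r ^ (n + 2))⁻¹ := by positivity
  have h := (measurableEmbedding_dilate (n := n) hr).integrable_map_iff (μ := volume)
    (g := rescale r H)
  rw [map_dilate_volume hr, integrable_smul_measure (ENNReal.ofReal_pos.2 hpos).ne'
    ENNReal.ofReal_ne_top] at h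
  refine h.2 ((hH.const_mul (r ^ (n + 2))⁻¹).congr (ae_of_all _ fun q => ?_))
  exact (rescale_dilate hr H q).symm

theorem IsCausalDensity.rescale (hH : IsCausalDensity H) {r : ℝ} (hr : 0 < r) :
    IsCausalDensity (rescale r H) where
  nonneg p := mul_nonneg (by positivity) (hH.nonneg _)
  integrable := integrable_rescale hr hH.integrable
  integral_eq_one := by
    simpa [hH.integral_eq_one] using integral_rescale_smul hr H fun _ => (1 : ℝ)
  eq_zero_of_neg p hp := by
    rw [CTRW.rescale, hH.eq_zero_of_neg _ (div_neg_of_neg_of_pos hp (by positivity)), mul_zero]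

theorem IsMeanValueKernel.isCausalDensity (hH : IsMeanValueKernel H) : IsCausalDensity H where
  nonneg := hH.nonneg
  integrable := hH.integrable
  integral_eq_one := hH.integral_eq_one
  eq_zero_of_neg p hp := by
    by_contra h
    exact absurd (hH.support_subset h) (not_le.2 hp)

/-- A radius `R ≥ 1` such that the kernel vanishes off the cylinder `|x| ≤ R`, `|t| ≤ R`. -/
theorem IsMeanValueKernel.exists_radius (hH : IsMeanValueKernel H) :
    ∃ R : ℝ, 1 ≤ R ∧ ∀ q : SpaceTime n, H q ≠ 0 → ‖q.1‖ ≤ R ∧ |q.2| ≤ R := by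
  obtain ⟨R, hR⟩ := hH.hasCompactSupport.isBounded.exists_norm_le
  refine ⟨max R 1, le_max_right _ _, fun q hq => ?_⟩
  have h : ‖q‖ ≤ max R 1 := (hR q (subset_tsupport H hq)).trans (le_max_left _ _)
  exact ⟨(norm_fst_le q).trans h, (norm_snd_le q).trans h⟩

/-! ### The mean value formula on exponentials -/

theorem fderiv_exp_inner_add (ξ : EuclideanSpace ℝ (Fin n)) (c : ℝ) :
    fderiv ℝ (fun x : EuclideanSpace ℝ (Fin n) => Real.exp (inner ℝ ξ x + c)) =
      fun x => Real.exp (inner ℝ ξ x + c) • innerSL ℝ ξ := by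
  funext x
  exact (((innerSL ℝ ξ).hasFDerivAt (x := x)).add_const c).exp.fderiv

theorem laplacian_exp_inner_add (ξ : EuclideanSpace ℝ (Fin n)) (c : ℝ)
    (x : EuclideanSpace ℝ (Fin n)) :
    Laplacian.laplacian (fun x : EuclideanSpace ℝ (Fin n) => Real.exp (inner ℝ ξ x + c)) x =
      ‖ξ‖ ^ 2 * Real.exp (inner ℝ ξ x + c) := by
  have h2 : HasFDerivAt
      (fun x : EuclideanSpace ℝ (Fin n) => Real.exp (inner ℝ ξ x + c) • innerSL ℝ ξ)
      ((Real.exp (inner ℝ ξ x + c) • innerSL ℝ ξ).smulRight (innerSL ℝ ξ)) x := by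
    have h1 : HasFDerivAt (fun x : EuclideanSpace ℝ (Fin n) => Real.exp (inner ℝ ξ x + c))
        (Real.exp (inner ℝ ξ x + c) • innerSL ℝ ξ) x :=
      (((innerSL ℝ ξ).hasFDerivAt (x := x)).add_const c).exp
    exact h1.smul_const (innerSL ℝ ξ)
  rw [InnerProductSpace.laplacian_eq_iteratedFDeriv_stdOrthonormalBasis]
  simp only [iteratedFDeriv_two_apply, fderiv_exp_inner_add]
  rw [h2.fderiv]
  have h3 := (stdOrthonormalBasis ℝ (EuclideanSpace ℝ (Fin n))).sum_sq_inner_left ξ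
  rw [← h3, Finset.sum_mul]
  refine Finset.sum_congr rfl fun i _ => ?_
  simp
  ring

/-- The exponentials `exp (ξ·x + |ξ|² t)` are temperatures on all of space-time. -/
theorem isTemperatureOn_exp (ξ : EuclideanSpace ℝ (Fin n)) :
    IsTemperatureOn (fun p : SpaceTime n => Real.exp (inner ℝ ξ p.1 + ‖ξ‖ ^ 2 * p.2))
      Set.univ where
  smooth := by
    have h : ContDiff ℝ (⊤ : ℕ∞) fun p : SpaceTime n =>
        Real.exp (inner ℝ ξ p.1 + ‖ξ‖ ^ 2 * p.2) :=
      Real.contDiff_exp.comp (((innerSL ℝ ξ).contDiff.comp contDiff_fst).add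
        (contDiff_const.mul contDiff_snd))
    exact h.contDiffOn
  heat p _ := by
    refine Eq.trans ?_ (laplacian_exp_inner_add ξ (‖ξ‖ ^ 2 * p.2) p.1).symm
    have h : HasDerivAt (fun t : ℝ => Real.exp (inner ℝ ξ p.1 + ‖ξ‖ ^ 2 * t))
        (Real.exp (inner ℝ ξ p.1 + ‖ξ‖ ^ 2 * p.2) * (‖ξ‖ ^ 2 * 1)) p.2 :=
      (((hasDerivAt_id p.2).const_mul (‖ξ‖ ^ 2)).const_add _).exp
    rw [h.deriv]
    ring

theorem IsMeanValueKernel.exists_integral_exp_eq_one (hH : IsMeanValueKernel H)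
    (ξ : EuclideanSpace ℝ (Fin n)) :
    ∃ r₀ : ℝ, 0 < r₀ ∧ ∀ r : ℝ, 0 < r → r < r₀ →
      ∫ q : SpaceTime n, H q * Real.exp (-(r * inner ℝ ξ q.1) - r ^ 2 * (‖ξ‖ ^ 2 * q.2)) = 1 := by
  obtain ⟨r₀, hr₀, h⟩ := hH.meanValue Set.univ isOpen_univ isConnected_univ _
    (isTemperatureOn_exp ξ) 0 (Set.mem_univ _)
  refine ⟨r₀, hr₀, fun r hr hrr => ?_⟩
  have h1 := h r hr hrr
  rw [conv_eq_integral] at h1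
  have h2 := integral_rescale_smul hr H fun q : SpaceTime n =>
    Real.exp (inner ℝ ξ (0 - q).1 + ‖ξ‖ ^ 2 * (0 - q).2)
  simp only [smul_eq_mul] at h2
  rw [h2] at h1
  refine Eq.trans ?_ (h1.symm.trans (by simp))
  congr 1 with q
  congr 2
  simp only [dilate, zero_sub, Prod.fst_neg, Prod.snd_neg, inner_neg_right, inner_smul_right]
  ring

/-- An exponential integral over a bounded set depends holomorphically on the parameter. -/
theorem differentiable_integral_mul_cexp {α : Type*} [MeasurableSpace α] {μ : Measure α}
    {h a b : α → ℝ} (hh : Integrable h μ) (ha : Measurable a) (hb : Measurable b) {R : ℝ}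
    (hR : ∀ q, h q ≠ 0 → |a q| ≤ R ∧ |b q| ≤ R) :
    Differentiable ℂ fun z : ℂ => ∫ q, (h q : ℂ) * Complex.exp (-(z * a q) - z ^ 2 * b q) ∂μ := by
  intro z₀
  have hmeas : ∀ z : ℂ, AEStronglyMeasurable
      (fun q => (h q : ℂ) * Complex.exp (-(z * a q) - z ^ 2 * b q)) μ := fun z =>
    (Complex.continuous_ofReal.comp_aestronglyMeasurable hh.aestronglyMeasurable).mul
      (by fun_prop : Measurable fun q =>
        Complex.exp (-(z * a q) - z ^ 2 * b q)).aestronglyMeasurable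
  have hmeas' : AEStronglyMeasurable
      (fun q => (h q : ℂ) * (Complex.exp (-(z₀ * a q) - z₀ ^ 2 * b q) *
        (-(a q : ℂ) - 2 * z₀ * b q))) μ :=
    (Complex.continuous_ofReal.comp_aestronglyMeasurable hh.aestronglyMeasurable).mul
      (by fun_prop : Measurable fun q => Complex.exp (-(z₀ * a q) - z₀ ^ 2 * b q) *
        (-(a q : ℂ) - 2 * z₀ * b q)).aestronglyMeasurable
  set B := ‖z₀‖ + 1 with hB
  have hB0 : 0 ≤ B := by positivity
  have hexp : ∀ z : ℂ, ‖z‖ ≤ B → ∀ q, h q ≠ 0 →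
      ‖Complex.exp (-(z * a q) - z ^ 2 * b q)‖ ≤ Real.exp (B * R + B ^ 2 * R) := by
    intro z hz q hq
    obtain ⟨haR, hbR⟩ := hR q hq
    refine (Complex.norm_exp_le_exp_norm _).trans (Real.exp_le_exp.2 ?_)
    refine (norm_sub_le _ _).trans ?_
    rw [norm_neg, norm_mul, norm_mul, norm_pow, Complex.norm_real, Complex.norm_real]
    exact add_le_add (mul_le_mul hz haR (abs_nonneg _) hB0)
      (mul_le_mul (pow_le_pow_left₀ (norm_nonneg _) hz 2) hbR (abs_nonneg _) (by positivity))
  have hball : ∀ z ∈ Metric.ball z₀ 1, ‖z‖ ≤ B := fun z hz => by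
    have h1 : ‖z - z₀‖ < 1 := by simpa [dist_eq_norm] using hz
    have h2 := norm_sub_norm_le z z₀
    linarith
  have hint : Integrable (fun q => (h q : ℂ) * Complex.exp (-(z₀ * a q) - z₀ ^ 2 * b q)) μ := by
    refine (hh.norm.mul_const (Real.exp (B * R + B ^ 2 * R))).mono' (hmeas z₀)
      (ae_of_all _ fun q => ?_)
    by_cases hq : h q = 0
    · simp [hq]
    · rw [norm_mul, Complex.norm_real]
      exact mul_le_mul_of_nonneg_left (hexp z₀ (by linarith) q hq) (norm_nonneg _)
  refine (hasDerivAt_integral_of_dominated_loc_of_deriv_le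
    (F' := fun z q => (h q : ℂ) * (Complex.exp (-(z * a q) - z ^ 2 * b q) *
      (-(a q : ℂ) - 2 * z * b q)))
    (bound := fun q => ‖h q‖ * (Real.exp (B * R + B ^ 2 * R) * (R + 2 * B * R)))
    (Metric.ball_mem_nhds z₀ one_pos) (Eventually.of_forall hmeas) hint hmeas'
    (ae_of_all _ fun q z hz => ?_) (hh.norm.mul_const _)
    (ae_of_all _ fun q z _ => ?_)).2.differentiableAt
  · by_cases hq : h q = 0
    · simp [hq]
    · obtain ⟨haR, hbR⟩ := hR q hq
      rw [norm_mul, norm_mul, Complex.norm_real]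
      refine mul_le_mul_of_nonneg_left (mul_le_mul (hexp z (hball z hz) q hq) ?_ (norm_nonneg _)
        (Real.exp_pos _).le) (norm_nonneg _)
      refine (norm_sub_le _ _).trans ?_
      rw [norm_neg, norm_mul, norm_mul, Complex.norm_real, Complex.norm_real, Complex.norm_ofNat]
      refine add_le_add haR (mul_le_mul ?_ hbR (abs_nonneg _) (by positivity))
      exact mul_le_mul_of_nonneg_left (hball z hz) zero_le_two
  · have h1 : HasDerivAt (fun z : ℂ => -(z * a q) - z ^ 2 * b q)
        (-(1 * (a q : ℂ)) - (2 : ℕ) * z ^ (2 - 1) * 1 * b q) z :=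
      (((hasDerivAt_id z).mul_const (a q : ℂ)).neg).sub
        (((hasDerivAt_id z).pow 2).mul_const (b q : ℂ))
    refine (h1.cexp.const_mul (h q : ℂ)).congr_deriv ?_
    push_cast
    ring

/-- The mean value formula, which is only assumed for small `r`, extends by analytic continuation
from real exponentials to the characters `exp (iξ·x - |ξ|²t)` at every scale. -/
theorem IsMeanValueKernel.integral_rescale_cexp (hH : IsMeanValueKernel H) {r : ℝ} (hr : 0 < r)
    (ξ : EuclideanSpace ℝ (Fin n)) :
    ∫ q : SpaceTime n, (rescale r H q : ℂ) *
      Complex.exp (q.2 * ‖ξ‖ ^ 2 - Complex.I * inner ℝ q.1 ξ) = 1 := by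
  obtain ⟨R, hR1, hR⟩ := hH.exists_radius
  obtain ⟨r₀, hr₀, h⟩ := hH.exists_integral_exp_eq_one ξ
  let G : ℂ → ℂ := fun z => ∫ q : SpaceTime n, (H q : ℂ) *
    Complex.exp (-(z * (inner ℝ ξ q.1 : ℝ)) - z ^ 2 * ((‖ξ‖ ^ 2 * q.2 : ℝ) : ℂ))
  have hG : Differentiable ℂ G := by
    refine differentiable_integral_mul_cexp (R := max (‖ξ‖ * R) (‖ξ‖ ^ 2 * R)) hH.integrable
      (by fun_prop) (by fun_prop) fun q hq => ⟨le_max_of_le_left ?_, le_max_of_le_right ?_⟩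
    · exact (abs_real_inner_le_norm _ _).trans
        (mul_le_mul_of_nonneg_left (hR q hq).1 (norm_nonneg _))
    · rw [abs_mul, abs_of_nonneg (sq_nonneg ‖ξ‖)]
      exact mul_le_mul_of_nonneg_left (hR q hq).2 (sq_nonneg _)
  have hGsmall : ∀ s : ℝ, 0 < s → s < r₀ → G (s : ℂ) = 1 := fun s hs hsr => by
    have h1 := congrArg (fun x : ℝ => (x : ℂ)) (h s hs hsr)
    rw [← integral_complex_ofReal] at h1
    simpa [G] using h1
  have hfreq : ∃ᶠ z in 𝓝[≠] (0 : ℂ), G z = 1 := by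
    have htend : Tendsto (fun s : ℝ => (s : ℂ)) (𝓝[>] 0) (𝓝[≠] 0) := by
      refine tendsto_nhdsWithin_iff.2 ⟨?_, ?_⟩
      · exact (Complex.continuous_ofReal.tendsto' 0 0 Complex.ofReal_zero).mono_left
          nhdsWithin_le_nhds
      · filter_upwards [self_mem_nhdsWithin] with s hs
        exact Complex.ofReal_ne_zero.2 (ne_of_gt hs)
    refine htend.frequently (Eventually.frequently ?_)
    filter_upwards [Ioo_mem_nhdsGT hr₀] with s hs using hGsmall s hs.1 hs.2
  have hG1 : G = fun _ => 1 :=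
    AnalyticOnNhd.eq_of_frequently_eq (fun z _ => hG.analyticAt z) (fun z _ => analyticAt_const)
      hfreq
  have h1 := integral_rescale_smul hr H fun q : SpaceTime n =>
    Complex.exp (q.2 * ‖ξ‖ ^ 2 - Complex.I * inner ℝ q.1 ξ)
  simp only [Complex.real_smul] at h1
  rw [h1]
  -- the character at scale `r` corresponds to the imaginary parameter `z = r I`
  refine Eq.trans ?_ (congrFun hG1 (r * Complex.I))
  simp only [G]
  congr 1 with q
  congr 2
  simp only [dilate, real_inner_smul_left, real_inner_comm q.1 ξ]
  push_cast
  rw [mul_pow, Complex.I_sq]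
  ring

/-! ### The mean value formula for the temperature, and its defect near the initial time -/

open Complex in
/-- By Fourier inversion and Fubini, a kernel that reproduces the characters `exp (iξ·x - |ξ|²t)`
reproduces the Weierstrass kernel as long as its support stays inside positive times. -/
theorem integral_mul_weierstrass_sub (hJ : IsCausalDensity J) {c : ℝ}
    (hc : ∀ q : SpaceTime n, J q ≠ 0 → q.2 ≤ c)
    (hchar : ∀ ξ : EuclideanSpace ℝ (Fin n),
      ∫ q : SpaceTime n, (J q : ℂ) * cexp (q.2 * ‖ξ‖ ^ 2 - I * inner ℝ q.1 ξ) = 1)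
    (x : EuclideanSpace ℝ (Fin n)) {t : ℝ} (hc0 : 0 ≤ c) (ht : c < t) :
    ∫ q : SpaceTime n, J q * weierstrass (x - q.1) (t - q.2) = weierstrass x t := by
  set k : ℂ := ((((2 * Real.pi) ^ n)⁻¹ : ℝ) : ℂ) with hk
  let F : SpaceTime n → EuclideanSpace ℝ (Fin n) → ℂ := fun q ξ =>
    (J q : ℂ) * cexp (-(t - q.2 : ℝ) * ‖ξ‖ ^ 2 + I * inner ℝ (x - q.1) ξ)
  have hgauss : Integrable fun ξ : EuclideanSpace ℝ (Fin n) =>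
      Real.exp (-(t - c) * ‖ξ‖ ^ 2) := by
    refine Integrable.of_integral_ne_zero ?_
    rw [GaussianFourier.integral_rexp_neg_mul_sq_norm (sub_pos.2 ht)]
    have : 0 < Real.pi / (t - c) := div_pos Real.pi_pos (sub_pos.2 ht)
    positivity
  have hF : Integrable (Function.uncurry F) (volume.prod volume) := by
    refine (hJ.integrable.norm.mul_prod hgauss).mono' ?_ (ae_of_all _ fun z => ?_)
    · refine (continuous_ofReal.comp_aestronglyMeasurable
        hJ.integrable.aestronglyMeasurable.comp_fst).mul (Continuous.aestronglyMeasurable ?_)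
      fun_prop
    · obtain ⟨q, ξ⟩ := z
      simp only [Function.uncurry, F]
      by_cases hq : J q = 0
      · simp [hq]
      · rw [norm_mul, Complex.norm_real, Complex.norm_exp]
        refine mul_le_mul_of_nonneg_left (Real.exp_le_exp.2 ?_) (norm_nonneg _)
        have hre : (-(t - q.2 : ℝ) * ‖ξ‖ ^ 2 + I * inner ℝ (x - q.1) ξ : ℂ).re =
            -(t - q.2) * ‖ξ‖ ^ 2 := by
          rw [add_re, ← ofReal_pow, ← ofReal_neg, ← ofReal_mul, ofReal_re]
          simp
        rw [hre]
        nlinarith [hc q hq, sq_nonneg ‖ξ‖]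
  have hleft : ∀ q : SpaceTime n,
      ((J q * weierstrass (x - q.1) (t - q.2) : ℝ) : ℂ) = k * ∫ ξ, F q ξ := fun q => by
    by_cases hq : J q = 0
    · simp [F, hq]
    · rw [ofReal_mul, weierstrass_eq_integral_cexp _ (by linarith [hc q hq]),
        integral_const_mul]
      ring
  have hright : ∀ ξ, ∫ q, F q ξ = cexp (-t * ‖ξ‖ ^ 2 + I * inner ℝ x ξ) := fun ξ => by
    rw [← mul_one (cexp _), ← hchar ξ, ← integral_const_mul]
    congr 1 with q
    simp only [F]
    rw [mul_left_comm, ← Complex.exp_add, inner_sub_left]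
    congr 2
    push_cast
    ring
  apply ofReal_injective
  rw [← integral_complex_ofReal, weierstrass_eq_integral_cexp x (hc0.trans_lt ht)]
  simp only [hleft, integral_const_mul]
  rw [integral_integral_swap hF]
  simp only [hright, hk]

/-- A kernel that reproduces the Weierstrass kernel at times after `c` reproduces every temperature
`W(·,t) ∗ f` there. -/
theorem integral_mul_temperature_sub (hJ : IsCausalDensity J) {c : ℝ}
    (hc : ∀ q : SpaceTime n, J q ≠ 0 → q.2 ≤ c) (hc0 : 0 ≤ c)
    (hW : ∀ (x : EuclideanSpace ℝ (Fin n)) {t : ℝ}, c < t →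
      ∫ q : SpaceTime n, J q * weierstrass (x - q.1) (t - q.2) = weierstrass x t)
    (hf : Measurable f) (hfM : ∀ x, |f x| ≤ M) (x : EuclideanSpace ℝ (Fin n)) {t : ℝ≥0}
    (ht : c < t) :
    conv J (extension f (temperature f)) (x, (t : ℝ)) = temperature f (x, t) := by
  let F : SpaceTime n → EuclideanSpace ℝ (Fin n) → ℝ := fun q z =>
    J q * (weierstrass (x - q.1 - z) (t - q.2) * f z)
  have hWi : ∀ q : SpaceTime n, J q ≠ 0 →
      Integrable fun z => weierstrass (x - q.1 - z) ((t : ℝ) - q.2) := fun q hq =>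
    (integrable_weierstrass (by linarith [hc q hq])).comp_sub_left (x - q.1)
  have hFm : AEStronglyMeasurable (Function.uncurry F) (volume.prod volume) := by
    refine hJ.integrable.aestronglyMeasurable.comp_fst.mul (Measurable.aestronglyMeasurable ?_)
    refine (measurable_weierstrass.comp (by fun_prop :
      Measurable fun z : SpaceTime n × EuclideanSpace ℝ (Fin n) =>
        (x - z.1.1 - z.2, (t : ℝ) - z.1.2))).mul (hf.comp measurable_snd)
  have hFi : Integrable (Function.uncurry F) (volume.prod volume) := by
    refine (integrable_prod_iff hFm).2 ⟨ae_of_all _ fun q => ?_, ?_⟩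
    · by_cases hq : J q = 0
      · simp [F, hq]
      · exact ((hWi q hq).mul_bdd (c := M) hf.aestronglyMeasurable
          (ae_of_all _ hfM)).const_mul (J q)
    · refine (hJ.integrable.norm.mul_const M).mono' hFm.norm.integral_prod_right'
        (ae_of_all _ fun q => ?_)
      by_cases hq : J q = 0
      · simp [F, hq]
      · have hpos : 0 < (t : ℝ) - q.2 := by linarith [hc q hq]
        have hint : ∫ z, ‖J q‖ * (weierstrass (x - q.1 - z) ((t : ℝ) - q.2) * M) = ‖J q‖ * M := by
          rw [integral_const_mul, integral_mul_const,
            integral_sub_left_eq_self (fun z => weierstrass z ((t : ℝ) - q.2)) volume (x - q.1),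
            integral_weierstrass hpos, one_mul]
        rw [← hint, Real.norm_of_nonneg (integral_nonneg fun z => norm_nonneg _)]
        refine integral_mono_of_nonneg (ae_of_all _ fun z => norm_nonneg _)
          (((hWi q hq).mul_const M).const_mul _) (ae_of_all _ fun z => ?_)
        simp only [Function.uncurry, F]
        have hW0 := weierstrass_nonneg (x - q.1 - z) hpos.le
        rw [norm_mul, norm_mul, Real.norm_of_nonneg hW0]
        exact mul_le_mul_of_nonneg_left (mul_le_mul_of_nonneg_left (hfM z) hW0) (norm_nonneg _)
  have hleft : ∀ q : SpaceTime n,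
      J q * extension f (temperature f) ((x, (t : ℝ)) - q) = ∫ z, F q z := fun q => by
    by_cases hq : J q = 0
    · simp [F, hq]
    · have hpos : 0 < (t : ℝ) - q.2 := by linarith [hc q hq]
      rw [integral_const_mul, extension_of_nonneg _ _ (by simpa using hpos.le), temperature,
        if_neg (by simpa using hpos)]
      simp only [Prod.fst_sub, Prod.snd_sub, Real.coe_toNNReal _ hpos.le]
  have hright : ∀ z, ∫ q, F q z = weierstrass (x - z) (t : ℝ) * f z := fun z => by
    rw [← hW (x - z) ht, ← integral_mul_const]
    congr 1 with q
    simp only [F]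
    rw [← mul_assoc, sub_right_comm]
  have ht0 : t ≠ 0 := fun h => by
    rw [h, NNReal.coe_zero] at ht
    exact absurd ht (not_lt.2 hc0)
  rw [conv_eq_integral, temperature, if_neg ht0]
  simp only [hleft]
  rw [integral_integral_swap hFi]
  simp only [hright]

/-- Within parabolic distance `ρ` of the initial hyperplane, the extended temperature differs from
the value of `f` at a point at distance at most `ρ` by a multiple of `ρ ^ γ`. -/
theorem abs_extension_temperature_sub_le {L γ ρ : ℝ} (hγ0 : 0 < γ) (hγ1 : γ ≤ 1)
    (hf : Measurable f) (hfM : ∀ x, |f x| ≤ M) (hL : 0 ≤ L)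
    (hfL : ∀ x y, |f x - f y| ≤ L * ‖x - y‖ ^ γ) (hρ : 0 ≤ ρ) {x : EuclideanSpace ℝ (Fin n)}
    {q : SpaceTime n} (hq1 : ‖q.1 - x‖ ≤ ρ) (hq2 : q.2 ≤ ρ ^ 2) :
    |extension f (temperature f) q - f x| ≤ L * (momentConst n + 1) * ρ ^ γ := by
  have hm := one_le_momentConst n
  have hspace : |f q.1 - f x| ≤ L * ρ ^ γ :=
    (hfL _ _).trans (mul_le_mul_of_nonneg_left
      (Real.rpow_le_rpow (norm_nonneg _) hq1 hγ0.le) hL)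
  have htime : |extension f (temperature f) q - f q.1| ≤ L * momentConst n * ρ ^ γ := by
    rcases lt_or_ge q.2 0 with hq | hq
    · rw [extension_of_neg _ _ hq, sub_self, abs_zero]
      positivity
    · rw [extension_of_nonneg _ _ hq]
      refine (abs_temperature_sub_le hγ0 hγ1 hf hfM hL hfL _ _).trans ?_
      rw [Real.coe_toNNReal _ hq]
      exact mul_le_mul_of_nonneg_left (Real.rpow_le_rpow (Real.sqrt_nonneg _)
        (Real.sqrt_le_iff.2 ⟨hρ, hq2⟩) hγ0.le) (by positivity)
  have htri := abs_sub_le (extension f (temperature f) q) (f q.1) (f x)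
  calc _ ≤ _ := htri
    _ ≤ L * momentConst n * ρ ^ γ + L * ρ ^ γ := add_le_add htime hspace
    _ = _ := by ring

/-- The defect of the temperature in `u = J ∗ ū` at times at most `ρ²`, for a kernel of spatial
radius `ρ`: both `J ∗ T̄` and `T` are close to `f x`. -/
theorem abs_conv_temperature_sub_le {L γ ρ : ℝ} (hJ : IsCausalDensity J) (hγ0 : 0 < γ)
    (hγ1 : γ ≤ 1) (hf : Measurable f) (hfM : ∀ x, |f x| ≤ M) (hL : 0 ≤ L)
    (hfL : ∀ x y, |f x - f y| ≤ L * ‖x - y‖ ^ γ) (hρ : 0 ≤ ρ)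
    (hsupp : ∀ q : SpaceTime n, J q ≠ 0 → ‖q.1‖ ≤ ρ) (x : EuclideanSpace ℝ (Fin n)) {t : ℝ≥0}
    (ht : (t : ℝ) ≤ ρ ^ 2) :
    |conv J (extension f (temperature f)) (x, (t : ℝ)) - temperature f (x, t)| ≤
      2 * (L * (momentConst n + 1) * ρ ^ γ) := by
  set δ := L * (momentConst n + 1) * ρ ^ γ
  have hT := measurable_extension hf (measurable_temperature hf)
  have hTM := abs_extension_le hfM (abs_temperature_le hfM)
  have h1 : |temperature f (x, t) - f x| ≤ δ := by
    rw [← extension_coe f (temperature f)]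
    exact abs_extension_temperature_sub_le hγ0 hγ1 hf hfM hL hfL hρ (by simpa using hρ) ht
  have h2 : |conv J (extension f (temperature f)) (x, (t : ℝ)) - f x| ≤ δ := by
    have heq : conv J (extension f (temperature f)) (x, (t : ℝ)) - f x =
        ∫ q : SpaceTime n, (J q * extension f (temperature f) ((x, (t : ℝ)) - q) - J q * f x) := by
      rw [integral_sub (integrable_mul_comp_sub hJ.integrable hT hTM _)
        (hJ.integrable.mul_const _), integral_mul_const, hJ.integral_eq_one, one_mul,
        conv_eq_integral]
    rw [heq, ← Real.norm_eq_abs]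
    calc _ ≤ ∫ q : SpaceTime n, J q * δ := by
          refine norm_integral_le_of_norm_le (hJ.integrable.mul_const _) (ae_of_all _ fun q => ?_)
          rw [← mul_sub, norm_mul, Real.norm_of_nonneg (hJ.nonneg q), Real.norm_eq_abs]
          by_cases hq : J q = 0
          · simp [hq]
          · refine mul_le_mul_of_nonneg_left (abs_extension_temperature_sub_le hγ0 hγ1 hf hfM hL
              hfL hρ ?_ ?_) (hJ.nonneg q)
            · simpa using hsupp q hq
            · have : 0 ≤ q.2 := by
                by_contra h
                exact hq (hJ.eq_zero_of_neg q (not_le.1 h))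
              simp only [Prod.snd_sub]
              linarith
      _ = δ := by rw [integral_mul_const, hJ.integral_eq_one, one_mul]
  rw [abs_le] at h1 h2 ⊢
  constructor <;> linarith [h1.1, h1.2, h2.1, h2.2]

/-! ### The rate of convergence -/

theorem integral_rescale_mul_exp {r : ℝ} (hr : 0 < r) (H : SpaceTime n → ℝ) :
    ∫ q : SpaceTime n, rescale r H q * Real.exp (-((r ^ 2)⁻¹ * q.2)) =
      ∫ q : SpaceTime n, H q * Real.exp (-(1 * q.2)) := by
  have h := integral_rescale_smul hr H fun q : SpaceTime n => Real.exp (-((r ^ 2)⁻¹ * q.2))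
  simp only [smul_eq_mul] at h
  rw [h]
  congr 1 with q
  congr 3
  simp only [dilate]
  field_simp

/-- The rate of convergence. Stability is applied with `lam = r⁻²` and `c = (R r)²`: then `lam * c`
and the Laplace transform of the waiting time are independent of `r`. -/
theorem IsMeanValueKernel.abs_solution_sub_temperature_le (hH : IsMeanValueKernel H) {R : ℝ}
    (hR1 : 1 ≤ R) (hR : ∀ q : SpaceTime n, H q ≠ 0 → ‖q.1‖ ≤ R ∧ |q.2| ≤ R) {L γ r : ℝ}
    (hγ0 : 0 < γ) (hγ1 : γ ≤ 1) (hf : Measurable f) (hfM : ∀ x, |f x| ≤ M) (hL : 0 ≤ L)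
    (hfL : ∀ x y, |f x - f y| ≤ L * ‖x - y‖ ^ γ) (hr : 0 < r)
    {u : (EuclideanSpace ℝ (Fin n) × ℝ≥0) →ᵇ ℝ} (hu : IsSolution (rescale r H) f u)
    (p : EuclideanSpace ℝ (Fin n) × ℝ≥0) :
    |u p - temperature f p| ≤ 2 * (momentConst n + 1) * R *
      (Real.exp (R ^ 2) / (1 - ∫ q : SpaceTime n, H q * Real.exp (-(1 * q.2)))) * L * r ^ γ := by
  have hR0 : 0 < R := by linarith
  have hρ0 : 0 < R * r := by positivity
  have hm := one_le_momentConst n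
  have hJ := hH.isCausalDensity.rescale hr
  have hlt := hH.isCausalDensity.integral_mul_exp_lt_one one_pos
  have hsupp : ∀ q : SpaceTime n, rescale r H q ≠ 0 → ‖q.1‖ ≤ R * r ∧ q.2 ≤ (R * r) ^ 2 := by
    intro q hq
    obtain ⟨h1, h2⟩ := hR _ (right_ne_zero_of_mul hq)
    simp only [norm_smul, norm_inv, Real.norm_of_nonneg hr.le] at h1
    have h3 := (le_abs_self _).trans h2
    rw [inv_mul_le_iff₀ hr] at h1
    rw [div_le_iff₀ (by positivity)] at h3
    refine ⟨by linarith, h3.trans ?_⟩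
    rw [mul_pow]
    exact mul_le_mul_of_nonneg_right (by nlinarith) (by positivity)
  have hdefect : ∀ (x : EuclideanSpace ℝ (Fin n)) (t : ℝ≥0),
      |conv (rescale r H) (extension f (temperature f)) (x, (t : ℝ)) - temperature f (x, t)| ≤
        if (t : ℝ) ≤ (R * r) ^ 2 then 2 * (L * (momentConst n + 1) * (R * r) ^ γ) else 0 := by
    intro x t
    split_ifs with ht
    · exact abs_conv_temperature_sub_le hJ hγ0 hγ1 hf hfM hL hfL hρ0.le
        (fun q hq => (hsupp q hq).1) x ht
    · rw [integral_mul_temperature_sub hJ (fun q hq => (hsupp q hq).2) (sq_nonneg _)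
        (fun x _ ht => integral_mul_weierstrass_sub hJ (fun q hq => (hsupp q hq).2)
          (hH.integral_rescale_cexp hr) x (sq_nonneg _) ht) hf hfM x (not_le.1 ht),
        sub_self, abs_zero]
  have hlam : 0 < (r ^ 2)⁻¹ := by positivity
  have h := hu.abs_sub_le hJ hlam (by positivity) hf hfM (measurable_temperature hf)
    ⟨M, abs_temperature_le hfM⟩ hdefect p
  have hexp : (r ^ 2)⁻¹ * (R * r) ^ 2 = R ^ 2 := by
    field_simp
  rw [integral_rescale_mul_exp hr, hexp] at h
  refine h.trans ?_
  have hRγ : (R * r) ^ γ ≤ R * r ^ γ := by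
    rw [Real.mul_rpow hR0.le hr.le]
    refine mul_le_mul_of_nonneg_right ?_ (by positivity)
    simpa using Real.rpow_le_rpow_of_exponent_le hR1 hγ1
  have hE : 0 ≤ Real.exp (R ^ 2) / (1 - ∫ q : SpaceTime n, H q * Real.exp (-(1 * q.2))) :=
    div_nonneg (Real.exp_pos _).le (by linarith)
  calc _ ≤ 2 * (L * (momentConst n + 1) * (R * r ^ γ)) *
        (Real.exp (R ^ 2) / (1 - ∫ q : SpaceTime n, H q * Real.exp (-(1 * q.2)))) := by
        gcongr
    _ = _ := by ring

end CTRW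

theorem theorem4 (n : ℕ) (H : EuclideanSpace ℝ (Fin n) × ℝ → ℝ)
    (hH : CTRW.IsMeanValueKernel H) :
    ∃ C : ℝ, 0 < C ∧ ∀ γ : ℝ≥0, 0 < γ → γ ≤ 1 →
      ∀ f : EuclideanSpace ℝ (Fin n) → ℝ, MemHolder γ f → (∃ M : ℝ, ∀ x, |f x| ≤ M) →
        ∃ u : ℝ → ((EuclideanSpace ℝ (Fin n) × ℝ≥0) →ᵇ ℝ),
          (∀ r : ℝ, 0 < r →
            CTRW.IsSolution (CTRW.rescale r H) f (u r) ∧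
            (∀ w : (EuclideanSpace ℝ (Fin n) × ℝ≥0) →ᵇ ℝ,
              CTRW.IsSolution (CTRW.rescale r H) f w → w = u r) ∧
            ∀ p : EuclideanSpace ℝ (Fin n) × ℝ≥0,
              |u r p - CTRW.temperature f p| ≤ C * (nnHolderNorm γ f : ℝ) * r ^ (γ : ℝ)) ∧
          TendstoUniformly (fun (r : ℝ) (p : EuclideanSpace ℝ (Fin n) × ℝ≥0) => u r p)
            (CTRW.temperature f) (𝓝[>] (0 : ℝ)) := by
  obtain ⟨R, hR1, hR⟩ := hH.exists_radius
  have hlt := hH.isCausalDensity.integral_mul_exp_lt_one one_pos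
  have hm := CTRW.one_le_momentConst n
  have hden : 0 < 1 - ∫ q : CTRW.SpaceTime n, H q * Real.exp (-(1 * q.2)) := by linarith
  refine ⟨2 * (CTRW.momentConst n + 1) * R *
    (Real.exp (R ^ 2) / (1 - ∫ q : CTRW.SpaceTime n, H q * Real.exp (-(1 * q.2)))),
    by positivity, fun γ hγ0 hγ1 f hfH ⟨M, hfM⟩ => ?_⟩
  set C := 2 * (CTRW.momentConst n + 1) * R *
    (Real.exp (R ^ 2) / (1 - ∫ q : CTRW.SpaceTime n, H q * Real.exp (-(1 * q.2))))
  have hf : Measurable f := (hfH.holderWith.continuous hγ0).measurable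
  have hfL : ∀ x y, |f x - f y| ≤ (nnHolderNorm γ f : ℝ) * ‖x - y‖ ^ (γ : ℝ) := fun x y => by
    simpa only [dist_eq_norm, Real.norm_eq_abs] using hfH.holderWith.dist_le x y
  have hsol : ∀ r : ℝ, ∃ u : (EuclideanSpace ℝ (Fin n) × ℝ≥0) →ᵇ ℝ, 0 < r →
      CTRW.IsSolution (CTRW.rescale r H) f u := fun r => by
    by_cases hr : 0 < r
    · obtain ⟨u, hu⟩ := CTRW.exists_isSolution (hH.isCausalDensity.rescale hr) hf hfM
      exact ⟨u, fun _ => hu⟩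
    · exact ⟨0, fun h => absurd h hr⟩
  choose u hu using hsol
  have hrate : ∀ r : ℝ, 0 < r → ∀ p : EuclideanSpace ℝ (Fin n) × ℝ≥0,
      |u r p - CTRW.temperature f p| ≤ C * (nnHolderNorm γ f : ℝ) * r ^ (γ : ℝ) := fun r hr =>
    hH.abs_solution_sub_temperature_le hR1 hR hγ0 (by exact_mod_cast hγ1) hf hfM
      (NNReal.coe_nonneg _) hfL hr (hu r hr)
  refine ⟨u, fun r hr => ⟨hu r hr, fun w hw =>
    hw.unique (hH.isCausalDensity.rescale hr) hf hfM (hu r hr), hrate r hr⟩, ?_⟩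
  rw [Metric.tendstoUniformly_iff]
  intro ε hε
  have hlim : Tendsto (fun r : ℝ => C * (nnHolderNorm γ f : ℝ) * r ^ (γ : ℝ)) (𝓝[>] 0) (𝓝 0) := by
    have h1 : Tendsto (fun r : ℝ => r ^ (γ : ℝ)) (𝓝[>] 0) (𝓝 0) :=
      ((Real.continuous_rpow_const (NNReal.coe_nonneg γ)).tendsto' 0 0
        (Real.zero_rpow (NNReal.coe_pos.2 hγ0).ne')).mono_left nhdsWithin_le_nhds
    simpa using h1.const_mul (C * (nnHolderNorm γ f : ℝ))
  filter_upwards [hlim.eventually_lt_const hε, self_mem_nhdsWithin] with r hr hr0 p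
  rw [dist_comm, Real.dist_eq]
  exact (hrate r hr0 p).trans_lt hr
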